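/- Let $m\ge 1$ be an integer. For real $q>1$ let $$\Gamma_{q,m}=\Big\{\sum_{i=1}^{\infty}\frac{c_i}{q^i} : c_i\in\{0,1,\ldots,m\}\text{ for all } i\Big\},$$ let $\mathcal U_{m,m}(q)$ be the set of real numbers $t$ for which there is exactly one sequence $(t_i)_{i\ge1}$ with $t_i\in\{-m,\ldots,-1,0,1,\ldots,m\}$ for all $i$ and $\sum_{i=1}^{\infty}t_i q^{-i}=t$, and set $$\mathcal D_{m,m}(q)=\big\{\dim_H\big(\Gamma_{q,m}\cap(\Gamma_{q,m}+t)\big) : t\in\mathcal U_{m,m}(q)\big\},$$ where $\dim_H$ denotes the Hausdorff dimension. Put $$c_1=\frac{\log m}{\log q},\qquad c_2=\frac{\log(m+1)}{\log q},\qquad q_c=\frac{m+2+\sqrt{m(m+4)}}{2}.$$ (i) If $q\in[q_c,\infty)$, then $[c_1,c_2]\subset\mathcal D_{m,m}(q)$. (ii) If $q\in(m+1,q_c)$, then there exists $\delta>0$ such that $\mathcal D_{m,m}(q)\cap(c_2-\delta,c_2)=\varnothing$. -/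

import Mathlib

open Set

noncomputable section

/-- `c` is an expansion of `x` in base `q` over the alphabet `Ω`:
`x = ∑_{i ≥ 1} c_i / q^i` with all digits in `Ω`.
The digit `c_i` of the mathematical notation is `c (i - 1)` here. -/
def IsExpansion (q : ℝ) (Ω : Set ℤ) (c : ℕ → ℤ) (x : ℝ) : Prop :=
  (∀ i, c i ∈ Ω) ∧ HasSum (fun i : ℕ => (c i : ℝ) / q ^ (i + 1)) x

/-- The set `Γ_{q,m}` of all numbers having an expansion in base `q` over `{0, 1, …, m}`. -/
def cantorGamma (q : ℝ) (m : ℕ) : Set ℝ :=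
  {x | ∃ c : ℕ → ℤ, IsExpansion q (Icc 0 (m : ℤ)) c x}

/-- The set `𝒰_{m₁,m₂}(q)` of all numbers having a unique expansion in base `q`
over the alphabet `{-m₂, …, -1, 0, 1, …, m₁}`. -/
def uniqueExpansionSet (m₁ m₂ : ℕ) (q : ℝ) : Set ℝ :=
  {t | ∃! c : ℕ → ℤ, IsExpansion q (Icc (-(m₂ : ℤ)) (m₁ : ℤ)) c t}

/-- The intersection `Γ_{q,m₁} ∩ (Γ_{q,m₂} + t)`. -/
def gammaInter (m₁ m₂ : ℕ) (q t : ℝ) : Set ℝ :=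
  cantorGamma q m₁ ∩ (fun x => x + t) '' cantorGamma q m₂

/-- The set `𝒟_{m₁,m₂}(q)` of the Hausdorff dimensions of `Γ_{q,m₁} ∩ (Γ_{q,m₂} + t)`,
where `t` runs over `𝒰_{m₁,m₂}(q)`. The Hausdorff dimension of a subset of the line is finite
(see `dimH_real_ne_top`), so `toReal` loses nothing. -/
def dimensionSet (m₁ m₂ : ℕ) (q : ℝ) : Set ℝ :=
  {d | ∃ t ∈ uniqueExpansionSet m₁ m₂ q, d = (dimH (gammaInter m₁ m₂ q t)).toReal}

theorem dimH_real_ne_top (s : Set ℝ) : dimH s ≠ ⊤ := by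
  have h : dimH s ≤ 1 := (dimH_mono (subset_univ s)).trans_eq Real.dimH_univ
  exact ne_top_of_le_ne_top ENNReal.one_ne_top h

/-- The critical base `q_c = (m + 2 + √(m (m + 4))) / 2`. -/
def criticalBase (m : ℕ) : ℝ :=
  ((m : ℝ) + 2 + Real.sqrt ((m : ℝ) * ((m : ℝ) + 4))) / 2

end

/-! If `t` has a unique expansion `(t_i)` over `{-m, …, m}`, a point `x = ∑ c_i / q^i` of `Γ` lies
in `Γ + t` exactly when every `c_i - t_i` is a digit in `{0, …, m}`. Place `i` therefore offers `m +
1 - |t_i|` consecutive digits, chosen independently of the other places (`gammaInter_eq_digitSet`).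
As `q > m + 1` separates the cylinders, the dimension is `log_q ρ` when the product of these counts
over `n` places is comparable to `ρ ^ n` (`dimH_digitSet_le`, `le_dimH_digitSet`). It remains to see
how sparse the nonzero digits of a unique expansion may be.

Uniqueness is governed by the tail values and the threshold `η = 1 - m / (q - 1)`. It holds if all
tails after the first digit lie in `(-η, η)`; for `q ≤ 2m + 1`, conversely, a digit above `-m`
forces the next tail above `-η`, and a digit below `m` forces it below `η`. The base `q_c` is where
`q η = 1`.

For `q ≥ q_c`, sequences of alternating `1` and `-1` separated by zeros have tails in `(-1/q, 1/q)`,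
hence are unique. Their nonzero digits can have any density `a` in `[0, 1]`, giving dimension `log_q
((m+1)^(1-a) m^a)`, which sweeps out `[c_1, c_2]`.

For `m + 1 < q < q_c`, a unique sequence that is not eventually zero has nonzero digits with gaps
bounded in terms of `q` and `m` only (`exists_window_of_lt_criticalBase`). This costs a fixed
proportion of the choices, hence a fixed amount of dimension; an eventually zero sequence gives at
least `c_2`. -/

/-! ### Values of digit sequences -/

/-- The value `∑ c_i / q^(i+1)` of a digit sequence in base `q`. -/
noncomputable def digitValue (q : ℝ) (c : ℕ → ℤ) : ℝ := ∑' i, (c i : ℝ) / q ^ (i + 1)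

/-- Prepend a digit to a sequence. -/
def consDigit (d : ℤ) (c : ℕ → ℤ) : ℕ → ℤ
  | 0 => d
  | i + 1 => c i

theorem summable_digit_div_pow {q : ℝ} (hq : 1 < q) {m : ℕ} {c : ℕ → ℤ}
    (hc : ∀ i, |c i| ≤ (m : ℤ)) : Summable fun i : ℕ => (c i : ℝ) / q ^ (i + 1) := by
  have hq0 : 0 < q := by linarith
  have hg : Summable fun i : ℕ => (m : ℝ) * q⁻¹ ^ (i + 1) :=
    ((summable_nat_add_iff 1).2 (summable_geometric_of_lt_one (inv_nonneg.2 hq0.le)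
      (inv_lt_one_of_one_lt₀ hq))).mul_left _
  refine Summable.of_norm_bounded hg fun i => ?_
  have h : |(c i : ℝ)| ≤ m := by exact_mod_cast hc i
  rw [Real.norm_eq_abs, abs_div, abs_of_pos (pow_pos hq0 (i + 1)), inv_pow, div_eq_mul_inv]
  gcongr

theorem digitValue_step {q : ℝ} (hq : 1 < q) {m : ℕ} {c : ℕ → ℤ}
    (hc : ∀ i, |c i| ≤ (m : ℤ)) :
    digitValue q c = ((c 0 : ℝ) + digitValue q fun i => c (i + 1)) / q := by
  rw [digitValue, (summable_digit_div_pow hq hc).tsum_eq_zero_add, digitValue, add_div, zero_add,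
    pow_one, ← tsum_div_const]
  congr 2
  funext i
  rw [pow_succ q (i + 1), div_div]

theorem hasSum_div_pow_succ {q : ℝ} (hq : 1 < q) (m : ℝ) :
    HasSum (fun i : ℕ => m / q ^ (i + 1)) (m / (q - 1)) := by
  have hq0 : 0 < q := by linarith
  have h := (hasSum_geometric_of_lt_one (inv_nonneg.2 hq0.le)
    (inv_lt_one_of_one_lt₀ hq)).mul_left (m / q)
  have hq1 : q - 1 ≠ 0 := by linarith
  have e1 : (fun i : ℕ => m / q * q⁻¹ ^ i) = fun i => m / q ^ (i + 1) := by
    funext i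
    rw [pow_succ, inv_pow]
    field_simp
  have e2 : m / q * (1 - q⁻¹)⁻¹ = m / (q - 1) := by
    have : 1 - q⁻¹ = (q - 1) / q := by field_simp
    rw [this, inv_div]
    field_simp
  rwa [e1, e2] at h

theorem abs_digitValue_le {q : ℝ} (hq : 1 < q) {m : ℕ} {c : ℕ → ℤ}
    (hc : ∀ i, |c i| ≤ (m : ℤ)) : |digitValue q c| ≤ m / (q - 1) := by
  have hq0 : 0 < q := by linarith
  rw [← Real.norm_eq_abs]
  refine tsum_of_norm_bounded (hasSum_div_pow_succ hq m) fun i => ?_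
  have h : |(c i : ℝ)| ≤ m := by exact_mod_cast hc i
  rw [Real.norm_eq_abs, abs_div, abs_of_pos (pow_pos hq0 (i + 1))]
  gcongr

theorem digitValue_sub {q : ℝ} (hq : 1 < q) {m : ℕ} {c d : ℕ → ℤ}
    (hc : ∀ i, |c i| ≤ (m : ℤ)) (hd : ∀ i, |d i| ≤ (m : ℤ)) :
    digitValue q (fun i => c i - d i) = digitValue q c - digitValue q d := by
  rw [digitValue, digitValue, digitValue,
    ← (summable_digit_div_pow hq hc).tsum_sub (summable_digit_div_pow hq hd)]
  congr 1
  funext i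
  push_cast
  ring

theorem digitValue_neg (q : ℝ) (c : ℕ → ℤ) :
    digitValue q (fun i => -c i) = -digitValue q c := by
  rw [digitValue, digitValue, ← tsum_neg]
  congr 1
  funext i
  push_cast
  ring

theorem digitValue_consDigit {q : ℝ} (hq : 1 < q) {m : ℕ} {d : ℤ} {c : ℕ → ℤ}
    (hd : |d| ≤ (m : ℤ)) (hc : ∀ i, |c i| ≤ (m : ℤ)) :
    digitValue q (consDigit d c) = (d + digitValue q c) / q := by
  have h : ∀ i, |consDigit d c i| ≤ (m : ℤ) := by rintro (_ | i); exacts [hd, hc i]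
  rw [digitValue_step hq h]
  rfl

theorem digitValue_sub_of_prefix_eq {q : ℝ} (hq : 1 < q) {m : ℕ} :
    ∀ (n : ℕ) {c d : ℕ → ℤ}, (∀ i, |c i| ≤ (m : ℤ)) → (∀ i, |d i| ≤ (m : ℤ)) →
      (∀ i < n, c i = d i) →
      digitValue q c - digitValue q d =
        (digitValue q (fun i => c (i + n)) - digitValue q fun i => d (i + n)) / q ^ n
  | 0, c, d, _, _, _ => by simp
  | n + 1, c, d, hc, hd, h => by
    have ih := digitValue_sub_of_prefix_eq hq n (c := fun i => c (i + 1))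
      (d := fun i => d (i + 1)) (fun i => hc _) (fun i => hd _) (fun i hi => h _ (by omega))
    rw [digitValue_step hq hc, digitValue_step hq hd, h 0 (by omega), ← sub_div,
      add_sub_add_left_eq_sub, ih, pow_succ, div_div]
    rfl

theorem isExpansion_iff {q : ℝ} (hq : 1 < q) {a b : ℤ} {m : ℕ} (ha : -(m : ℤ) ≤ a)
    (hb : b ≤ m) {c : ℕ → ℤ} {x : ℝ} :
    IsExpansion q (Set.Icc a b) c x ↔ (∀ i, a ≤ c i ∧ c i ≤ b) ∧ digitValue q c = x := by
  refine and_congr_right fun h => ⟨fun hs => hs.tsum_eq, fun hv => ?_⟩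
  have hc : ∀ i, |c i| ≤ (m : ℤ) := fun i => abs_le.2 ⟨ha.trans (h i).1, (h i).2.trans hb⟩
  rw [← hv]
  exact (summable_digit_div_pow hq hc).hasSum

/-! ### Expansions over the symmetric alphabet and their uniqueness -/

/-- Every number in `[-m/(q-1), m/(q-1)]` has an expansion over `{-m, …, m}`
when `q ≤ 2m + 1`. -/
theorem exists_digitValue_eq {q : ℝ} (hq : 1 < q) {m : ℕ} (hqm : q ≤ 2 * m + 1) {x : ℝ}
    (hx : |x| ≤ m / (q - 1)) :
    ∃ c : ℕ → ℤ, (∀ i, |c i| ≤ (m : ℤ)) ∧ digitValue q c = x := by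
  have hq0 : 0 < q := by linarith
  have hq1 : 0 < q - 1 := by linarith
  set B : ℝ := m / (q - 1) with hB
  have hBq : q * B = m + B := by
    rw [hB]; field_simp; ring
  have hhalf : 1 / 2 ≤ B := by rw [hB, div_le_div_iff₀ two_pos hq1]; linarith
  -- The digit is the integer nearest to `q * y`, clamped to `[-m, m]`. Unclamped, the remainder is
  -- at most `1/2 ≤ B`; clamped, `q * B = m + B` bounds it.
  have key : ∀ y : ℝ, ∃ d : ℤ, |d| ≤ (m : ℤ) ∧ (|y| ≤ B → |q * y - d| ≤ B) := by
    intro y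
    have hr := abs_le.1 (abs_sub_round (q * y))
    rcases lt_or_ge (m : ℤ) (round (q * y)) with h | h
    · refine ⟨m, by simp, fun hy => ?_⟩
      have h' : (m : ℝ) + 1 ≤ round (q * y) := by exact_mod_cast h
      have := mul_le_mul_of_nonneg_left (abs_le.1 hy).2 hq0.le
      rw [abs_le]; push_cast
      constructor <;> linarith
    rcases lt_or_ge (round (q * y)) (-(m : ℤ)) with h2 | h2
    · refine ⟨-m, by simp, fun hy => ?_⟩
      have h' : (round (q * y) : ℝ) + 1 ≤ -m := by exact_mod_cast h2
      have := mul_le_mul_of_nonneg_left (abs_le.1 hy).1 hq0.le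
      rw [abs_le]; push_cast
      constructor <;> linarith
    · exact ⟨_, abs_le.2 ⟨h2, h⟩, fun _ => (abs_sub_round _).trans hhalf⟩
  choose d hd hdB using key
  let r : ℕ → ℝ := fun n => Nat.rec x (fun _ y => q * y - d y) n
  have hr : ∀ n, |r n| ≤ B := by
    intro n
    induction n with
    | zero => exact hx
    | succ n ih => exact hdB _ ih
  have hc : ∀ i, |d (r i)| ≤ (m : ℤ) := fun i => hd _
  refine ⟨fun i => d (r i), hc, ?_⟩
  have hpart : ∀ n, ∑ i ∈ Finset.range n, (d (r i) : ℝ) / q ^ (i + 1) = x - r n / q ^ n := by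
    intro n
    induction n with
    | zero => simp [r]
    | succ n ih =>
      have : r (n + 1) = q * r n - d (r n) := rfl
      rw [Finset.sum_range_succ, ih, this]
      field_simp
      ring
  have h1 := (summable_digit_div_pow hq hc).hasSum.tendsto_sum_nat
  refine tendsto_nhds_unique h1 ?_
  simp_rw [hpart]
  have h0 : Filter.Tendsto (fun n => r n / q ^ n) Filter.atTop (nhds 0) := by
    refine squeeze_zero_norm (a := fun n => B * q⁻¹ ^ n) (fun n => ?_) ?_
    · rw [Real.norm_eq_abs, abs_div, abs_of_pos (pow_pos hq0 n), inv_pow, div_eq_mul_inv]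
      gcongr
      exact hr n
    · simpa using (tendsto_pow_atTop_nhds_zero_of_lt_one (inv_nonneg.2 hq0.le)
        (inv_lt_one_of_one_lt₀ hq)).const_mul B
  simpa using h0.const_sub x

/-- `c` is the only sequence over `{-m, …, m}` with its value in base `q`. -/
def IsUniqueDigits (q : ℝ) (m : ℕ) (c : ℕ → ℤ) : Prop :=
  (∀ i, |c i| ≤ (m : ℤ)) ∧
    ∀ d : ℕ → ℤ, (∀ i, |d i| ≤ (m : ℤ)) → digitValue q d = digitValue q c → d = c

theorem mem_uniqueExpansionSet_iff {q : ℝ} (hq : 1 < q) {m : ℕ} {t : ℝ} :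
    t ∈ uniqueExpansionSet m m q ↔ ∃ c, IsUniqueDigits q m c ∧ digitValue q c = t := by
  have h : ∀ c : ℕ → ℤ, IsExpansion q (Set.Icc (-(m : ℤ)) m) c t ↔
      (∀ i, |c i| ≤ (m : ℤ)) ∧ digitValue q c = t := fun c => by
    rw [isExpansion_iff hq le_rfl le_rfl]
    simp_rw [abs_le]
  change (∃! c, IsExpansion q (Set.Icc (-(m : ℤ)) m) c t) ↔ _
  simp_rw [h]
  constructor
  · rintro ⟨c, ⟨hc, hv⟩, hu⟩
    exact ⟨c, ⟨hc, fun d hd hdv => hu d ⟨hd, hdv.trans hv⟩⟩, hv⟩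
  · rintro ⟨c, ⟨hc, hu⟩, hv⟩
    exact ⟨c, ⟨hc, hv⟩, fun d hd => hu d hd.1 (hd.2.trans hv.symm)⟩

theorem IsUniqueDigits.neg {q : ℝ} {m : ℕ} {c : ℕ → ℤ} (h : IsUniqueDigits q m c) :
    IsUniqueDigits q m fun i => -c i := by
  refine ⟨fun i => by rw [abs_neg]; exact h.1 i, fun d hd hv => ?_⟩
  rw [digitValue_neg] at hv
  have := h.2 (fun i => -d i) (fun i => by rw [abs_neg]; exact hd i)
    (by rw [digitValue_neg, hv, neg_neg])
  funext i
  rw [← this, neg_neg]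

theorem IsUniqueDigits.tail {q : ℝ} (hq : 1 < q) {m : ℕ} {c : ℕ → ℤ}
    (h : IsUniqueDigits q m c) : IsUniqueDigits q m fun i => c (i + 1) := by
  refine ⟨fun i => h.1 _, fun d hd hv => ?_⟩
  have := h.2 (consDigit (c 0) d) (by rintro (_ | i); exacts [h.1 0, hd i])
    (by rw [digitValue_consDigit hq (h.1 0) hd, hv, digitValue_step hq h.1])
  funext i
  exact congrFun this (i + 1)

theorem IsUniqueDigits.drop {q : ℝ} (hq : 1 < q) {m : ℕ} {c : ℕ → ℤ}
    (h : IsUniqueDigits q m c) : ∀ n, IsUniqueDigits q m fun i => c (i + n)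
  | 0 => h
  | n + 1 => by
    convert (IsUniqueDigits.drop hq h n).tail hq using 3
    omega

/-- Otherwise the tail plus `1` still lies in `[-m/(q-1), m/(q-1)]` and so has an expansion;
lowering the leading digit by one and using that expansion gives a second representation. -/
theorem IsUniqueDigits.neg_lt_digitValue_tail {q : ℝ} (hq : 1 < q) {m : ℕ}
    (hqm : q ≤ 2 * m + 1) {c : ℕ → ℤ} (h : IsUniqueDigits q m c)
    (h0 : -(m : ℤ) < c 0) : -(1 - m / (q - 1)) < digitValue q fun i => c (i + 1) := by
  by_contra! hlt
  have hb := abs_le.1 (abs_digitValue_le hq (c := fun i => c (i + 1)) fun i => h.1 _)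
  obtain ⟨d, hd, hdv⟩ := exists_digitValue_eq hq hqm
    (x := digitValue q (fun i => c (i + 1)) + 1) (abs_le.2 ⟨by linarith, by linarith⟩)
  have hc0 := abs_le.1 (h.1 0)
  have h1 : |c 0 - 1| ≤ (m : ℤ) := abs_le.2 ⟨by omega, by omega⟩
  have := h.2 (consDigit (c 0 - 1) d) (by rintro (_ | i); exacts [h1, hd i])
    (by rw [digitValue_consDigit hq h1 hd, hdv, digitValue_step hq h.1]; push_cast; ring)
  have := congrFun this 0
  simp [consDigit] at this

theorem IsUniqueDigits.digitValue_tail_lt {q : ℝ} (hq : 1 < q) {m : ℕ}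
    (hqm : q ≤ 2 * m + 1) {c : ℕ → ℤ} (h : IsUniqueDigits q m c)
    (h0 : c 0 < m) : digitValue q (fun i => c (i + 1)) < 1 - m / (q - 1) := by
  have := h.neg.neg_lt_digitValue_tail hq hqm (by simpa using h0)
  rw [digitValue_neg q fun i => c (i + 1)] at this
  linarith

/-- At the first place where a competitor differs, the digits differ by at least `1`, so the two
tails do too. The competitor's tail is at most `m/(q-1)` in absolute value, which leaves no room. -/
theorem isUniqueDigits_of_abs_tail_lt {q : ℝ} (hq : 1 < q) {m : ℕ} {c : ℕ → ℤ}
    (hc : ∀ i, |c i| ≤ (m : ℤ))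
    (h : ∀ n, |digitValue q fun i => c (i + (n + 1))| < 1 - m / (q - 1)) :
    IsUniqueDigits q m c := by
  refine ⟨hc, fun d hd hv => ?_⟩
  have hq0 : 0 < q := by linarith
  by_contra hne
  have hex : ∃ n, d n ≠ c n := by
    by_contra! h'
    exact hne (funext h')
  have hpre := digitValue_sub_of_prefix_eq hq (Nat.find hex) hd hc
    fun i hi => not_not.1 (Nat.find_min hex hi)
  have hn := Nat.find_spec hex
  set n := Nat.find hex
  rw [hv, sub_self, eq_comm, div_eq_zero_iff, or_iff_left (pow_pos hq0 n).ne',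
    digitValue_step hq (c := fun i => d (i + n)) (fun i => hd _),
    digitValue_step hq (c := fun i => c (i + n)) (fun i => hc _), ← sub_div, div_eq_zero_iff,
    or_iff_left hq0.ne'] at hpre
  have e : (fun i => c (i + 1 + n)) = fun i => c (i + (n + 1)) := by
    funext i; congr 1; omega
  rw [e] at hpre
  have h1 := abs_lt.1 (h n)
  have h2 := abs_le.1 (abs_digitValue_le hq (c := fun i => d (i + 1 + n)) fun i => hd _)
  simp only [zero_add] at hpre
  rcases lt_or_gt_of_ne hn with hlt | hgt
  · have : (d n : ℝ) + 1 ≤ c n := by exact_mod_cast hlt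
    linarith
  · have : (c n : ℝ) + 1 ≤ d n := by exact_mod_cast hgt
    linarith

/-! ### Hausdorff dimension of digit sets -/

/-- Numbers with digits `lo i ≤ c i < lo i + M i` in base `q`. -/
def digitSet (q : ℝ) (lo : ℕ → ℤ) (M : ℕ → ℕ) : Set ℝ :=
  {x | ∃ c : ℕ → ℤ, (∀ i, lo i ≤ c i ∧ c i < lo i + M i) ∧ digitValue q c = x}

theorem rpow_logb_pow {q ρ : ℝ} (hq : 1 < q) (hρ : 0 < ρ) (n : ℕ) :
    (q ^ n) ^ Real.logb q ρ = ρ ^ n := by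
  have hq0 : 0 < q := by linarith
  rw [← Real.rpow_natCast q, ← Real.rpow_mul hq0.le, mul_comm, Real.rpow_mul hq0.le,
    Real.rpow_logb hq0 hq.ne' hρ, Real.rpow_natCast]

/-- Cover by the cylinders of rank `n`: at most `C * ρ ^ n` sets of diameter at most `2 / q ^ n`.
With `q ^ s = ρ` their `s`-sums are bounded by `C * 2 ^ s`, so the `s`-dimensional measure is
finite. -/
theorem dimH_digitSet_le {q : ℝ} {m : ℕ} (hm : 1 ≤ m) (hq : (m : ℝ) + 1 < q) {lo : ℕ → ℤ}
    {M : ℕ → ℕ} (hlo : ∀ i, 0 ≤ lo i) (hM : ∀ i, lo i + M i ≤ m + 1) {C ρ : ℝ} (hρ : 1 ≤ ρ)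
    (hN : ∀ n, ((∏ i ∈ Finset.range n, M i : ℕ) : ℝ) ≤ C * ρ ^ n) :
    dimH (digitSet q lo M) ≤ ENNReal.ofReal (Real.logb q ρ) := by
  have hm' : (1 : ℝ) ≤ m := by exact_mod_cast hm
  have hq1 : 1 < q := by linarith
  have hq0 : 0 < q := by linarith
  have hρ0 : 0 < ρ := by linarith
  set s := Real.logb q ρ with hs
  have hs0 : 0 ≤ s := Real.logb_nonneg hq1 hρ
  have habs : ∀ c : ℕ → ℤ, (∀ i, lo i ≤ c i ∧ c i < lo i + M i) → ∀ i, |c i| ≤ (m : ℤ) :=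
    fun c hc i => abs_le.2 ⟨by linarith [hlo i, hc i], by linarith [hM i, hc i]⟩
  let t : ∀ n : ℕ, ((i : Fin n) → Fin (M i)) → Set ℝ := fun n w =>
    {x | ∃ c : ℕ → ℤ, (∀ i, lo i ≤ c i ∧ c i < lo i + M i) ∧
      (∀ i : Fin n, c i = lo i + (w i : ℕ)) ∧ digitValue q c = x}
  have hdiam : ∀ n w, Metric.ediam (t n w) ≤ ENNReal.ofReal (2 / q ^ n) := by
    refine fun n w => Metric.ediam_le ?_
    rintro x ⟨c, hc, hcw, rfl⟩ y ⟨d, hd, hdw, rfl⟩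
    rw [edist_dist, Real.dist_eq]
    refine ENNReal.ofReal_le_ofReal ?_
    rw [digitValue_sub_of_prefix_eq hq1 n (habs c hc) (habs d hd)
      (fun i hi => (hcw ⟨i, hi⟩).trans (hdw ⟨i, hi⟩).symm), abs_div, abs_of_pos (pow_pos hq0 n)]
    have h1 := abs_le.1 (abs_digitValue_le hq1 (c := fun i => c (i + n)) fun i => habs c hc _)
    have h2 := abs_le.1 (abs_digitValue_le hq1 (c := fun i => d (i + n)) fun i => habs d hd _)
    have h3 : m / (q - 1) ≤ 1 := by rw [div_le_one (by linarith)]; linarith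
    gcongr
    rw [abs_le]
    constructor <;> linarith
  have hcover : ∀ n, digitSet q lo M ⊆ ⋃ w, t n w := by
    rintro n x ⟨c, hc, hx⟩
    refine mem_iUnion.2 ⟨fun i => ⟨(c i - lo i).toNat, ?_⟩, c, hc, fun i => ?_, hx⟩
    · have := hc i; omega
    · have := hc i; simp only; omega
  have htend : Filter.Tendsto (fun n : ℕ => ENNReal.ofReal (2 / q ^ n)) Filter.atTop (nhds 0) := by
    rw [← ENNReal.ofReal_zero]
    refine ENNReal.tendsto_ofReal ?_
    have := (tendsto_pow_atTop_nhds_zero_of_lt_one (inv_nonneg.2 hq0.le)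
      (inv_lt_one_of_one_lt₀ hq1)).const_mul 2
    simpa [div_eq_mul_inv] using this
  have hmeas := MeasureTheory.Measure.hausdorffMeasure_le_liminf_sum s (digitSet q lo M)
    _ htend t (Filter.Eventually.of_forall hdiam) (Filter.Eventually.of_forall hcover)
  have hsum : ∀ n, ∑ w, Metric.ediam (t n w) ^ s ≤ ENNReal.ofReal (C * 2 ^ s) := by
    intro n
    have hp : 0 < 2 / q ^ n := by positivity
    calc ∑ w, Metric.ediam (t n w) ^ s
        ≤ ∑ _w : (i : Fin n) → Fin (M i), ENNReal.ofReal ((2 / q ^ n) ^ s) := by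
          refine Finset.sum_le_sum fun w _ => ?_
          rw [← ENNReal.ofReal_rpow_of_pos hp]
          exact ENNReal.rpow_le_rpow (hdiam n w) hs0
      _ = ENNReal.ofReal ((∏ i ∈ Finset.range n, M i : ℕ) * (2 / q ^ n) ^ s) := by
          rw [Finset.sum_const, Finset.card_univ, Fintype.card_pi, nsmul_eq_mul,
            ENNReal.ofReal_mul (Nat.cast_nonneg _), ENNReal.ofReal_natCast, Finset.prod_range]
          simp
      _ ≤ ENNReal.ofReal (C * 2 ^ s) := by
          refine ENNReal.ofReal_le_ofReal ?_
          rw [Real.div_rpow two_pos.le (pow_pos hq0 n).le, hs, rpow_logb_pow hq1 hρ0,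
            mul_div_assoc', div_le_iff₀ (pow_pos hρ0 n)]
          have := mul_le_mul_of_nonneg_right (hN n) (Real.rpow_nonneg two_pos.le (Real.logb q ρ))
          linarith
  have hfin : MeasureTheory.Measure.hausdorffMeasure s (digitSet q lo M) ≠ ⊤ := by
    refine ne_top_of_le_ne_top (b := ENNReal.ofReal (C * 2 ^ s)) ENNReal.ofReal_ne_top
      (hmeas.trans ?_)
    refine (Filter.liminf_le_liminf (Filter.Eventually.of_forall hsum)).trans_eq ?_
    exact Filter.liminf_const _
  have hs' : ((s.toNNReal : NNReal) : ℝ) = s := Real.coe_toNNReal s hs0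
  rw [← hs'] at hfin
  exact dimH_le_of_hausdorffMeasure_ne_top hfin

/-- The first nonzero digit of `c - d` contributes at least `1`, and the later ones, again bounded
by `m`, at most `m / (q - 1)`. -/
theorem gap_le_abs_digitValue_sub {q : ℝ} (hq : 1 < q) {m : ℕ} {c d : ℕ → ℤ}
    (hc : ∀ i, |c i| ≤ (m : ℤ)) (hd : ∀ i, |d i| ≤ (m : ℤ)) (hcd : ∀ i, |c i - d i| ≤ (m : ℤ))
    {k : ℕ} (hpre : ∀ i < k, c i = d i) (hne : c k ≠ d k) :
    (1 - m / (q - 1)) / q ^ (k + 1) ≤ |digitValue q c - digitValue q d| := by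
  have hq0 : 0 < q := by linarith
  rw [digitValue_sub_of_prefix_eq hq k hc hd hpre, ← digitValue_sub hq (fun i => hc _)
    (fun i => hd _), digitValue_step hq (fun i => hcd _), div_div, abs_div,
    abs_of_pos (mul_pos hq0 (pow_pos hq0 k)), ← pow_succ']
  have h1 := abs_digitValue_le hq (c := fun i => c (i + 1 + k) - d (i + 1 + k)) fun i => hcd _
  have h2 : (1 : ℝ) ≤ |((c k - d k : ℤ) : ℝ)| := by
    exact_mod_cast Int.one_le_abs (sub_ne_zero.2 hne)
  have h3 := abs_sub_abs_le_abs_add ((c k - d k : ℤ) : ℝ)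
    (digitValue q fun i => c (i + 1 + k) - d (i + 1 + k))
  simp only [zero_add]
  gcongr
  linarith

/-- Reading the mixed-radix digits of `y ∈ [0, 1)` (radices `M i`) in base `q` maps `[0, 1)` into
the digit set. The inverse is Hölder of exponent `s` and has image of dimension `1`, so the digit
set has dimension at least `s`. -/
theorem le_dimH_digitSet {q : ℝ} {m : ℕ} (hm : 1 ≤ m) (hq : (m : ℝ) + 1 < q) {lo : ℕ → ℤ}
    {M : ℕ → ℕ} (hlo : ∀ i, 0 ≤ lo i) (hM : ∀ i, lo i + M i ≤ m + 1) {C ρ : ℝ} (hρ : 1 ≤ ρ)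
    (hC : 0 < C) (hN : ∀ n, C * ρ ^ n ≤ ((∏ i ∈ Finset.range n, M i : ℕ) : ℝ)) :
    ENNReal.ofReal (Real.logb q ρ) ≤ dimH (digitSet q lo M) := by
  rcases hρ.eq_or_lt with rfl | hρ1
  · simp
  have hm' : (1 : ℝ) ≤ m := by exact_mod_cast hm
  have hq1 : 1 < q := by linarith
  have hq0 : 0 < q := by linarith
  have hρ0 : 0 < ρ := by linarith
  set s := Real.logb q ρ with hs
  have hs0 : 0 < s := Real.logb_pos hq1 hρ1
  set N : ℕ → ℕ := fun n => ∏ i ∈ Finset.range n, M i with hNdef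
  have hNs : ∀ n, N (n + 1) = N n * M n := fun n => Finset.prod_range_succ _ _
  have hN0 : ∀ n, (0 : ℝ) < N n := fun n => lt_of_lt_of_le (by positivity) (hN n)
  have hMpos : ∀ n, 0 < M n := fun n => by
    have h : 0 < N (n + 1) := by exact_mod_cast hN0 (n + 1)
    rw [hNs] at h
    exact Nat.pos_of_mul_pos_left h
  -- The bracket is the mixed-radix digit of `y` in place `n`; `lo n` shifts it into the allowed
  -- range.
  set e : ℝ → ℕ → ℤ := fun y n => lo n + (⌊(N (n + 1) : ℝ) * y⌋ - M n * ⌊(N n : ℝ) * y⌋) with he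
  have hdig : ∀ y i, lo i ≤ e y i ∧ e y i < lo i + M i := by
    intro y i
    have h1 : (N (i + 1) : ℝ) * y = M i * (N i * y) := by rw [hNs]; push_cast; ring
    have hMi : (0 : ℝ) < M i := by exact_mod_cast hMpos i
    have h2 : (M i : ℤ) * ⌊(N i : ℝ) * y⌋ ≤ ⌊(N (i + 1) : ℝ) * y⌋ := by
      rw [Int.le_floor, h1]
      push_cast
      exact mul_le_mul_of_nonneg_left (Int.floor_le _) hMi.le
    have h3 : ⌊(N (i + 1) : ℝ) * y⌋ < (M i : ℤ) * (⌊(N i : ℝ) * y⌋ + 1) := by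
      rw [Int.floor_lt, h1]
      push_cast
      exact mul_lt_mul_of_pos_left (Int.lt_floor_add_one _) hMi
    simp only [he]
    constructor <;> linarith
  have habs : ∀ y i, |e y i| ≤ (m : ℤ) := fun y i =>
    abs_le.2 ⟨by linarith [hlo i, hdig y i], by linarith [hM i, hdig y i]⟩
  have hdiff : ∀ y z i, |e y i - e z i| ≤ (m : ℤ) := fun y z i =>
    abs_le.2 ⟨by linarith [hlo i, hM i, hdig y i, hdig z i],
      by linarith [hlo i, hM i, hdig y i, hdig z i]⟩
  set η : ℝ := 1 - m / (q - 1) with hη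
  have hη0 : 0 < η := by rw [hη, sub_pos, div_lt_one (by linarith)]; linarith
  set g : ℝ → ℝ := fun y => digitValue q (e y) with hg
  -- If the digits first differ in place `k`, then `|y - z| ≤ 1 / (C * ρ ^ k)` while the images are
  -- at least `η / q ^ (k + 1)` apart; `K` is the resulting ratio.
  set K : ℝ := ρ / (C * η ^ s) with hK
  have hK0 : 0 < K := by positivity
  have key : ∀ y ∈ Ico (0 : ℝ) 1, ∀ z ∈ Ico (0 : ℝ) 1, |y - z| ≤ K * |g y - g z| ^ s := by
    intro y hy z hz
    rcases eq_or_ne y z with rfl | hyz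
    · simp [Real.zero_rpow hs0.ne']
    have hex : ∃ n, ⌊(N n : ℝ) * y⌋ ≠ ⌊(N n : ℝ) * z⌋ := by
      by_contra! h
      obtain ⟨n, hn⟩ := pow_unbounded_of_one_lt (1 / (C * |y - z|)) hρ1
      have hpos : 0 < |y - z| := abs_pos.2 (sub_ne_zero.2 hyz)
      rw [div_lt_iff₀ (by positivity)] at hn
      have h1 := Int.abs_sub_lt_one_of_floor_eq_floor (h n)
      rw [← mul_sub, abs_mul, abs_of_pos (hN0 n)] at h1
      have := mul_le_mul_of_nonneg_right (hN n) hpos.le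
      linarith
    have hfind := Nat.find_spec hex
    have hmin : ∀ i, i < Nat.find hex → ⌊(N i : ℝ) * y⌋ = ⌊(N i : ℝ) * z⌋ :=
      fun i hi => not_not.1 (Nat.find_min hex hi)
    -- The empty product is `N 0 = 1`, so both floors vanish at level `0`.
    obtain ⟨k, hk⟩ : ∃ k, Nat.find hex = k + 1 := by
      refine Nat.exists_eq_succ_of_ne_zero fun h0 => hfind ?_
      rw [h0]
      simp [hNdef, Int.floor_eq_zero_iff.2 hy, Int.floor_eq_zero_iff.2 hz]
    rw [hk] at hfind hmin
    have hgap : η / q ^ (k + 1) ≤ |g y - g z| := by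
      refine gap_le_abs_digitValue_sub hq1 (habs y) (habs z) (hdiff y z) (fun i hi => ?_) ?_
      · simp only [he]
        rw [hmin i (by omega), hmin (i + 1) (by omega)]
      · simp only [he]
        rw [hmin k (by omega)]
        intro h
        exact hfind (by linarith)
    have hclose := Int.abs_sub_lt_one_of_floor_eq_floor (hmin k (by omega))
    rw [← mul_sub, abs_mul, abs_of_pos (hN0 k)] at hclose
    calc |y - z| ≤ 1 / (C * ρ ^ k) := by
          rw [le_div_iff₀ (by positivity)]
          have := mul_le_mul_of_nonneg_right (hN k) (abs_nonneg (y - z))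
          linarith
      _ = K * (η / q ^ (k + 1)) ^ s := by
          rw [Real.div_rpow hη0.le (pow_pos hq0 _).le, hK]
          have : (q ^ (k + 1)) ^ s = ρ ^ (k + 1) := rpow_logb_pow hq1 hρ0 _
          rw [this]
          have : 0 < η ^ s := by positivity
          field_simp
          rw [pow_succ]
      _ ≤ K * |g y - g z| ^ s := by
          have : 0 ≤ η / q ^ (k + 1) := by positivity
          gcongr
  have hinj : InjOn g (Ico 0 1) := by
    intro y hy z hz h
    have := key y hy z hz
    rw [h, sub_self, abs_zero, Real.zero_rpow hs0.ne', mul_zero] at this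
    exact sub_eq_zero.1 (abs_eq_zero.1 (le_antisymm this (abs_nonneg _)))
  set f := Function.invFunOn g (Ico 0 1) with hf
  have hleft : LeftInvOn f g (Ico 0 1) := hinj.leftInvOn_invFunOn
  have hholder : HolderOnWith K.toNNReal s.toNNReal f (g '' Ico 0 1) := by
    rintro _ ⟨y, hy, rfl⟩ _ ⟨z, hz, rfl⟩
    rw [hleft hy, hleft hz, Real.coe_toNNReal s hs0.le, edist_dist, edist_dist,
      ENNReal.ofReal_rpow_of_nonneg dist_nonneg hs0.le, ← ENNReal.ofReal,
      ← ENNReal.ofReal_mul hK0.le]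
    exact ENNReal.ofReal_le_ofReal (key y hy z hz)
  have hdim := hholder.dimH_image_le (Real.toNNReal_pos.2 hs0)
  rw [hleft.image_image, Real.dimH_of_nonempty_interior (by simp [interior_Ico])] at hdim
  simp only [Module.finrank_self, Nat.cast_one] at hdim
  have hs' : ((s.toNNReal : NNReal) : ENNReal) = ENNReal.ofReal s := rfl
  have hne : ENNReal.ofReal s ≠ 0 := by simpa using hs0
  rw [hs', ENNReal.le_div_iff_mul_le (Or.inl hne) (Or.inl ENNReal.ofReal_ne_top), one_mul] at hdim
  refine hdim.trans (dimH_mono ?_)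
  rintro _ ⟨y, _, rfl⟩
  exact ⟨e y, hdig y, rfl⟩

/-! ### Intersections as digit sets -/

/-- For a unique digit sequence `t`, the digits of the points of `Γ ∩ (Γ + ∑ t_i / q^(i+1))`
can be chosen independently, with `m + 1 - |t_i|` choices in place `i`. -/
theorem gammaInter_eq_digitSet {q : ℝ} (hq : 1 < q) {m : ℕ} {t : ℕ → ℤ}
    (ht : IsUniqueDigits q m t) :
    gammaInter m m q (digitValue q t) =
      digitSet q (fun i => max 0 (t i)) fun i => m + 1 - (t i).natAbs := by
  have hm0 : -(m : ℤ) ≤ 0 := by omega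
  have hexp : ∀ c x, IsExpansion q (Icc 0 (m : ℤ)) c x ↔
    (∀ i, 0 ≤ c i ∧ c i ≤ (m : ℤ)) ∧ digitValue q c = x := fun c x => isExpansion_iff hq hm0 le_rfl
  have habs : ∀ c : ℕ → ℤ, (∀ i, 0 ≤ c i ∧ c i ≤ (m : ℤ)) → ∀ i, |c i| ≤ (m : ℤ) :=
    fun c hc i => abs_le.2 ⟨by linarith [hc i], (hc i).2⟩
  ext x
  constructor
  · rintro ⟨⟨c, hc⟩, y, ⟨d, hd⟩, hy⟩
    rw [hexp] at hc hd
    -- Uniqueness turns the equality of values `x - y = t` into equality digit by digit.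
    have := ht.2 (fun i => c i - d i) (fun i => abs_le.2
      ⟨by linarith [hc.1 i, hd.1 i], by linarith [hc.1 i, hd.1 i]⟩)
      (by rw [digitValue_sub hq (habs c hc.1) (habs d hd.1), hc.2, hd.2, ← hy]; simp)
    refine ⟨c, fun i => ?_, hc.2⟩
    have h1 : c i - d i = t i := congrFun this i
    have h2 := hc.1 i
    have h3 := hd.1 i
    have h4 := abs_le.1 (ht.1 i)
    simp only
    constructor <;> omega
  · rintro ⟨c, hc, rfl⟩
    simp only at hc
    have h1 : ∀ i, 0 ≤ c i ∧ c i ≤ (m : ℤ) := fun i => by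
      have := hc i
      have := abs_le.1 (ht.1 i)
      constructor <;> omega
    have h2 : ∀ i, 0 ≤ c i - t i ∧ c i - t i ≤ (m : ℤ) := fun i => by
      have := hc i
      have := abs_le.1 (ht.1 i)
      constructor <;> omega
    refine ⟨⟨c, (hexp _ _).2 ⟨h1, rfl⟩⟩, digitValue q (fun i => c i - t i),
      ⟨_, (hexp _ _).2 ⟨h2, rfl⟩⟩, ?_⟩
    simp only
    rw [digitValue_sub hq (habs c h1) ht.1, sub_add_cancel]

theorem dimH_gammaInter_le {q : ℝ} {m : ℕ} (hm : 1 ≤ m) (hq : (m : ℝ) + 1 < q) {t : ℕ → ℤ}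
    (ht : IsUniqueDigits q m t) {C ρ : ℝ} (hρ : 1 ≤ ρ)
    (hN : ∀ n, ((∏ i ∈ Finset.range n, (m + 1 - (t i).natAbs) : ℕ) : ℝ) ≤ C * ρ ^ n) :
    (dimH (gammaInter m m q (digitValue q t))).toReal ≤ Real.logb q ρ := by
  have hq1 : 1 < q := by linarith [(Nat.cast_nonneg m : (0 : ℝ) ≤ m)]
  rw [gammaInter_eq_digitSet hq1 ht]
  refine ENNReal.toReal_le_of_le_ofReal (Real.logb_nonneg hq1 hρ)
    (dimH_digitSet_le hm hq (fun i => le_max_left _ _) (fun i => ?_) hρ hN)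
  have := abs_le.1 (ht.1 i)
  omega

theorem le_dimH_gammaInter {q : ℝ} {m : ℕ} (hm : 1 ≤ m) (hq : (m : ℝ) + 1 < q) {t : ℕ → ℤ}
    (ht : IsUniqueDigits q m t) {C ρ : ℝ} (hρ : 1 ≤ ρ) (hC : 0 < C)
    (hN : ∀ n, C * ρ ^ n ≤ ((∏ i ∈ Finset.range n, (m + 1 - (t i).natAbs) : ℕ) : ℝ)) :
    Real.logb q ρ ≤ (dimH (gammaInter m m q (digitValue q t))).toReal := by
  have hq1 : 1 < q := by linarith [(Nat.cast_nonneg m : (0 : ℝ) ≤ m)]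
  rw [← ENNReal.ofReal_le_iff_le_toReal (dimH_real_ne_top _), gammaInter_eq_digitSet hq1 ht]
  refine le_dimH_digitSet hm hq (fun i => le_max_left _ _) (fun i => ?_) hρ hC hN
  have := abs_le.1 (ht.1 i)
  omega

/-! ### The critical base -/

/-- `criticalBase m` is the larger root of `q ^ 2 - (m + 2) * q + 1`, whose sign for `q > 1` decides
between `1 / q` and `1 - m / (q - 1)`. -/
theorem one_div_le_of_criticalBase_le {q : ℝ} {m : ℕ} (hm : 1 ≤ m) (hq : criticalBase m ≤ q) :
    (m : ℝ) + 1 < q ∧ 1 / q ≤ 1 - m / (q - 1) := by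
  have hm' : (1 : ℝ) ≤ m := by exact_mod_cast hm
  have hs := Real.sq_sqrt (show (0 : ℝ) ≤ m * (m + 4) by positivity)
  have hs0 := Real.sqrt_nonneg ((m : ℝ) * (m + 4))
  unfold criticalBase at hq
  set r := Real.sqrt ((m : ℝ) * (m + 4))
  have h1 : (m : ℝ) < r := by nlinarith
  have h2 : (m : ℝ) + 1 < q := by linarith
  refine ⟨h2, ?_⟩
  have h3 : 0 ≤ q ^ 2 - (m + 2) * q + 1 := by nlinarith
  rw [one_sub_div (by linarith), div_le_div_iff₀ (by linarith) (by linarith)]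
  nlinarith

theorem mul_gap_lt_one_of_lt_criticalBase {q : ℝ} {m : ℕ} (hm : 1 ≤ m) (hq : (m : ℝ) + 1 < q)
    (hqc : q < criticalBase m) : q ≤ 2 * m + 1 ∧ q * (1 - m / (q - 1)) < 1 := by
  have hm' : (1 : ℝ) ≤ m := by exact_mod_cast hm
  have hs := Real.sq_sqrt (show (0 : ℝ) ≤ m * (m + 4) by positivity)
  have hs0 := Real.sqrt_nonneg ((m : ℝ) * (m + 4))
  unfold criticalBase at hqc
  set r := Real.sqrt ((m : ℝ) * (m + 4))
  have h3 : q ^ 2 - (m + 2) * q + 1 < 0 := by nlinarith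
  refine ⟨by nlinarith, ?_⟩
  rw [one_sub_div (by linarith), mul_div_assoc', div_lt_one (by linarith)]
  nlinarith

/-! ### Bases at least `q_c`: every dimension in `[c_1, c_2]` -/

/-- With `v` the value of the shifted `ε`, the difference has value `((q - 1) * v + (1 - ε 0)) / q -
1 / q`. The last hypothesis excludes only `ε = 1, 0, 0, …`, which would give exactly `-(1 / q)`. -/
theorem neg_inv_lt_digitValue_diff {q : ℝ} (hq : 1 < q) {ε : ℕ → ℤ} (h0 : ∀ i, 0 ≤ ε i)
    (h1 : ∀ i, ε i ≤ 1) (h : ε 0 = 0 ∨ ∃ j, 0 < j ∧ ε j = 1) :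
    -(1 / q) < digitValue q fun i => ε (i + 1) - ε i := by
  have hq0 : 0 < q := by linarith
  have hε : ∀ i, |ε i| ≤ ((1 : ℕ) : ℤ) := fun i =>
    abs_le.2 ⟨by push_cast; linarith [h0 i], by exact_mod_cast h1 i⟩
  rw [digitValue_sub hq (c := fun i => ε (i + 1)) (fun i => hε _) hε, digitValue_step hq hε]
  set v := digitValue q fun i => ε (i + 1) with hv
  have hterm : ∀ i, 0 ≤ (ε (i + 1) : ℝ) / q ^ (i + 1) := fun i =>
    div_nonneg (by exact_mod_cast h0 _) (pow_pos hq0 _).le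
  have hv0 : 0 ≤ v := tsum_nonneg hterm
  have hkey : 0 < (q - 1) * v + (1 - ε 0) := by
    rcases h with h | ⟨j, hj, hj1⟩
    · rw [h]; push_cast
      have := mul_nonneg (sub_pos.2 hq).le hv0
      linarith
    · have hvpos : 0 < v := by
        refine (summable_digit_div_pow hq (c := fun i => ε (i + 1)) fun i => hε _).tsum_pos hterm
          (j - 1) ?_
        rw [Nat.sub_add_cancel hj, hj1]
        positivity
      have := mul_pos (sub_pos.2 hq) hvpos
      have h2 : (ε 0 : ℝ) ≤ 1 := by exact_mod_cast h1 0
      linarith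
  have e : v - (ε 0 + v) / q = ((q - 1) * v + (1 - ε 0)) / q - 1 / q := by
    field_simp
    ring
  rw [e]
  have := div_pos hkey hq0
  linarith

/-- Differences of a binary sequence are the sequences in `{-1, 0, 1}` with alternating signs. The
lower bound for tails comes from `ε`, the upper one from its complement `1 - ε`; `hone` and `hzero`
keep both strict, as needed when `q = q_c`. -/
theorem isUniqueDigits_diff {q : ℝ} {m : ℕ} (hm : 1 ≤ m) (hq : criticalBase m ≤ q) {ε : ℕ → ℤ}
    (h0 : ∀ i, 0 ≤ ε i) (h1 : ∀ i, ε i ≤ 1) (hone : ∀ n, ε n = 0 ∨ ∃ j, n < j ∧ ε j = 1)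
    (hzero : ∀ n, ε n = 1 ∨ ∃ j, n < j ∧ ε j = 0) :
    IsUniqueDigits q m fun i => ε (i + 1) - ε i := by
  obtain ⟨hmq, hgap⟩ := one_div_le_of_criticalBase_le hm hq
  have hq1 : 1 < q := by linarith [(Nat.cast_nonneg m : (0 : ℝ) ≤ m)]
  refine isUniqueDigits_of_abs_tail_lt hq1 (fun i => abs_le.2 ⟨?_, ?_⟩) fun n => ?_
  · have := h0 (i + 1); have := h1 i; omega
  · have := h1 (i + 1); have := h0 i; omega
  refine lt_of_lt_of_le (abs_lt.2 ⟨?_, ?_⟩) hgap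
  · have key := neg_inv_lt_digitValue_diff hq1 (ε := fun i => ε (i + (n + 1))) (fun i => h0 _)
      (fun i => h1 _) ?_
    · have e : (fun i => ε (i + 1 + (n + 1)) - ε (i + (n + 1))) =
          fun i => ε (i + (n + 1) + 1) - ε (i + (n + 1)) := by
        funext i
        rw [show i + 1 + (n + 1) = i + (n + 1) + 1 by omega]
      rwa [e] at key
    · refine (hone (n + 1)).imp (fun h => by simpa using h) ?_
      rintro ⟨j, hj, hj1⟩
      exact ⟨j - (n + 1), by omega, by rw [Nat.sub_add_cancel hj.le, hj1]⟩
  · have key := neg_inv_lt_digitValue_diff hq1 (ε := fun i => 1 - ε (i + (n + 1)))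
      (fun i => by linarith [h1 (i + (n + 1))]) (fun i => by linarith [h0 (i + (n + 1))]) ?_
    · have e : (fun i => (1 - ε (i + 1 + (n + 1))) - (1 - ε (i + (n + 1)))) =
          fun i => -(ε (i + (n + 1) + 1) - ε (i + (n + 1))) := by
        funext i
        rw [show i + 1 + (n + 1) = i + (n + 1) + 1 by omega]
        ring
      rw [e, digitValue_neg q fun i => ε (i + (n + 1) + 1) - ε (i + (n + 1))] at key
      linarith
    · refine (hzero (n + 1)).imp (fun h => by simp [h]) ?_
      rintro ⟨j, hj, hj1⟩
      exact ⟨j - (n + 1), by omega, by rw [Nat.sub_add_cancel hj.le, hj1, sub_zero]⟩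

theorem exists_gt_floor_mul_mod_two_eq {a : ℝ} (ha : 0 < a) (ha1 : a ≤ 1) (n r : ℕ) (hr : r < 2) :
    ∃ j : ℕ, n < j ∧ ⌊a * j⌋₊ % 2 = r := by
  -- An integer of parity `r` exceeding `⌊a * n⌋₊`; since `a ≤ 1`, the values `⌊a * j⌋₊` skip no
  -- integer and `j = ⌈k / a⌉₊` attains it.
  set k : ℕ := 2 * (⌊a * n⌋₊ + 1) + r with hk
  have h1 := Nat.le_ceil ((k : ℝ) / a)
  have h2 := Nat.ceil_lt_add_one (div_nonneg (Nat.cast_nonneg k) ha.le)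
  rw [div_le_iff₀ ha] at h1
  have h3 : a * (⌈(k : ℝ) / a⌉₊ : ℝ) < k + a := by
    have := mul_lt_mul_of_pos_left h2 ha
    rwa [mul_add, mul_div_cancel₀ _ ha.ne', mul_one] at this
  have hf : ⌊a * (⌈(k : ℝ) / a⌉₊ : ℝ)⌋₊ = k := by
    rw [Nat.floor_eq_iff (by positivity)]
    constructor <;> linarith
  refine ⟨⌈(k : ℝ) / a⌉₊, ?_, by rw [hf]; omega⟩
  by_contra! hle
  have : ⌊a * (⌈(k : ℝ) / a⌉₊ : ℝ)⌋₊ ≤ ⌊a * n⌋₊ := by gcongr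
  omega

/-- Take `ε n` to be the parity of `⌊a * n⌋₊`. The difference sequence is `±1` exactly where this
floor jumps, so its nonzero digits have density `a`, and the number of choices in `n` places is
`(m+1)^n * β ^ ⌊a * n⌋₊`. -/
theorem exists_dimH_gammaInter_eq {q : ℝ} {m : ℕ} (hm : 1 ≤ m) (hq : criticalBase m ≤ q) {a : ℝ}
    (ha : 0 ≤ a) (ha1 : a ≤ 1) :
    ∃ t, IsUniqueDigits q m t ∧ (dimH (gammaInter m m q (digitValue q t))).toReal =
      Real.logb q (((m : ℝ) + 1) * ((m : ℝ) / (m + 1)) ^ a) := by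
  have hmq := (one_div_le_of_criticalBase_le hm hq).1
  have hm' : (1 : ℝ) ≤ m := by exact_mod_cast hm
  set β : ℝ := (m : ℝ) / (m + 1) with hβ
  have hβ0 : 0 < β := by positivity
  have hβ1 : β ≤ 1 := by rw [hβ, div_le_one (by positivity)]; linarith
  set ρ : ℝ := ((m : ℝ) + 1) * β ^ a with hρdef
  have hρ : 1 ≤ ρ := by
    calc (1 : ℝ) ≤ m := hm'
      _ = (m + 1) * β ^ (1 : ℝ) := by rw [Real.rpow_one, hβ]; field_simp
      _ ≤ ρ := by
        exact mul_le_mul_of_nonneg_left (Real.rpow_le_rpow_of_exponent_ge hβ0 hβ1 ha1)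
          (by positivity)
  let k : ℕ → ℕ := fun n => ⌊a * n⌋₊
  have hk : ∀ n, k (n + 1) = k n ∨ k (n + 1) = k n + 1 := by
    intro n
    have h1 : k n ≤ k (n + 1) :=
      Nat.floor_le_floor (mul_le_mul_of_nonneg_left (by push_cast; linarith) ha)
    have h2 : k (n + 1) ≤ k n + 1 := by
      rw [← Nat.floor_add_one (by positivity)]
      refine Nat.floor_le_floor ?_
      push_cast
      linarith
    omega
  let ε : ℕ → ℤ := fun n => ((k n % 2 : ℕ) : ℤ)
  have hab : ∀ i, (ε (i + 1) - ε i).natAbs = k (i + 1) - k i := fun i => by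
    simp only [ε]
    rcases hk i with h | h <;> rw [h] <;> omega
  have hfreq : 0 < a → ∀ n r : ℕ, r < 2 → ∃ j, n < j ∧ ε j = r := fun ha0 n r hr => by
    obtain ⟨j, hj, hjr⟩ := exists_gt_floor_mul_mod_two_eq ha0 ha1 n r hr
    exact ⟨j, hj, congrArg _ hjr⟩
  have huniq : IsUniqueDigits q m fun i => ε (i + 1) - ε i := by
    refine isUniqueDigits_diff hm hq (fun i => ?_) (fun i => ?_) (fun n => ?_) (fun n => ?_)
    · simp only [ε]; omega
    · simp only [ε]; omega
    · rcases ha.eq_or_lt with rfl | ha0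
      · left; simp [ε, k]
      · right; exact_mod_cast hfreq ha0 n 1 (by omega)
    · rcases ha.eq_or_lt with rfl | ha0
      · right; exact ⟨n + 1, by omega, by simp [ε, k]⟩
      · right; exact_mod_cast hfreq ha0 n 0 (by omega)
  have hN : ∀ n, ((∏ i ∈ Finset.range n, (m + 1 - (ε (i + 1) - ε i).natAbs) : ℕ) : ℝ) =
      ((m : ℝ) + 1) ^ n * β ^ k n := by
    intro n
    induction n with
    | zero => simp [k]
    | succ n ih =>
      rw [Finset.prod_range_succ, Nat.cast_mul, ih, hab, pow_succ]
      rcases hk n with h | h <;> rw [h]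
      · simp
        ring
      · rw [pow_succ, hβ]
        simp
        field_simp
  have hρn : ∀ n : ℕ, ρ ^ n = ((m : ℝ) + 1) ^ n * β ^ (a * n) := fun n => by
    rw [hρdef, mul_pow, Real.rpow_mul hβ0.le, Real.rpow_natCast]
  -- Replacing `⌊a * n⌋₊` by `a * n` changes the exponent of `β` by less than `1`, hence the
  -- constants `β⁻¹` and `1`.
  refine ⟨_, huniq, le_antisymm (dimH_gammaInter_le hm hmq huniq (C := β⁻¹) hρ fun n => ?_)
    (le_dimH_gammaInter hm hmq huniq (C := 1) hρ one_pos fun n => ?_)⟩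
  · rw [hN, hρn]
    have h1 : β ^ k n ≤ β⁻¹ * β ^ (a * n) := by
      rw [← Real.rpow_natCast, ← Real.rpow_neg_one, ← Real.rpow_add hβ0]
      refine Real.rpow_le_rpow_of_exponent_ge hβ0 hβ1 ?_
      have := Nat.lt_floor_add_one (a * n)
      simp only [k]
      linarith
    calc _ ≤ ((m : ℝ) + 1) ^ n * (β⁻¹ * β ^ (a * n)) := by gcongr
      _ = _ := by ring
  · rw [hN, hρn, one_mul, ← Real.rpow_natCast β]
    have h1 : β ^ (a * n) ≤ β ^ (k n : ℝ) :=
      Real.rpow_le_rpow_of_exponent_ge hβ0 hβ1 (Nat.floor_le (by positivity))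
    gcongr

/-! ### Bases below `q_c`: a gap under the maximal dimension -/

/-- The interval `(-η, η)` traps tails. From `|c 0 + τ| < q * η < 1`, a nonzero leading digit forces
a tail `τ` of the opposite sign with `|τ| > 1 - q * η`, and uniqueness bounds it by `η`. -/
theorem IsUniqueDigits.abs_tail_lt {q : ℝ} {m : ℕ} (hm : 1 ≤ m) (hq : (m : ℝ) + 1 < q)
    (hqc : q < criticalBase m) {c : ℕ → ℤ} (hc : IsUniqueDigits q m c)
    (h : |digitValue q c| < 1 - m / (q - 1)) :
    |digitValue q fun i => c (i + 1)| < 1 - m / (q - 1) ∧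
      (c 0 ≠ 0 → 1 - q * (1 - m / (q - 1)) < |digitValue q fun i => c (i + 1)|) := by
  obtain ⟨hqm, hη⟩ := mul_gap_lt_one_of_lt_criticalBase hm hq hqc
  have hq1 : 1 < q := by linarith [(Nat.cast_nonneg m : (0 : ℝ) ≤ m)]
  have hq0 : 0 < q := by linarith
  have hA := hc.neg_lt_digitValue_tail hq1 hqm
  have hB := hc.digitValue_tail_lt hq1 hqm
  have hstep := digitValue_step hq1 hc.1
  set η : ℝ := 1 - m / (q - 1)
  set τ := digitValue q fun i => c (i + 1)
  rw [hstep, abs_div, abs_of_pos hq0, div_lt_iff₀ hq0, abs_lt] at h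
  rcases lt_trichotomy (c 0) 0 with h0 | h0 | h0
  · have h1 : (c 0 : ℝ) + 1 ≤ 0 := by exact_mod_cast h0
    have h2 : 0 < τ := by linarith
    rw [abs_of_pos h2]
    exact ⟨hB (by omega), fun _ => by linarith⟩
  · exact ⟨abs_lt.2 ⟨hA (by omega), hB (by omega)⟩, fun h => absurd h0 h⟩
  · have h1 : (1 : ℝ) ≤ c 0 := by exact_mod_cast h0
    have h2 : τ < 0 := by linarith
    rw [abs_of_neg h2]
    exact ⟨by linarith [hA (by omega)], fun _ => by linarith⟩

/-- Below the critical base, a unique digit sequence is eventually zero or has nonzero digits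
with uniformly bounded gaps from some place on. -/
theorem exists_window_of_lt_criticalBase {q : ℝ} {m : ℕ} (hm : 1 ≤ m) (hq : (m : ℝ) + 1 < q)
    (hqc : q < criticalBase m) :
    ∃ K : ℕ, 0 < K ∧ ∀ c, IsUniqueDigits q m c →
      (∃ p, ∀ n, p ≤ n → c n = 0) ∨ ∃ p, ∀ n, p ≤ n → ∃ j < K, c (n + j) ≠ 0 := by
  obtain ⟨hqm, hη⟩ := mul_gap_lt_one_of_lt_criticalBase hm hq hqc
  have hm' : (1 : ℝ) ≤ m := by exact_mod_cast hm
  have hq1 : 1 < q := by linarith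
  have hq0 : 0 < q := by linarith
  -- A tail beginning with `K` zeros has absolute value at most `q⁻¹ ^ K`, too small to follow a
  -- nonzero digit once the tails are trapped.
  obtain ⟨K, hK⟩ := exists_pow_lt_of_lt_one (sub_pos.2 hη) (inv_lt_one_of_one_lt₀ hq1)
  refine ⟨K + 1, K.succ_pos, fun c hc => ?_⟩
  set η : ℝ := 1 - m / (q - 1) with hηdef
  by_cases hgood : ∃ p, |digitValue q fun i => c (i + p)| < η
  swap
  -- If no tail enters `(-η, η)`, no digit is zero, since a zero digit would put the next tail
  -- there.
  · right
    push Not at hgood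
    refine ⟨0, fun n _ => ⟨0, K.succ_pos, fun h0 => ?_⟩⟩
    have h0' : c (0 + n) = 0 := by simpa using h0
    have hA := (hc.drop hq1 n).neg_lt_digitValue_tail hq1 hqm (by rw [h0']; omega)
    have hB := (hc.drop hq1 n).digitValue_tail_lt hq1 hqm (by rw [h0']; omega)
    have := hgood (n + 1)
    have e : (fun i => c (i + 1 + n)) = fun i => c (i + (n + 1)) := by
      funext i; congr 1; omega
    rw [e] at hA hB
    exact absurd (abs_lt.2 ⟨hA, hB⟩) (not_lt.2 this)
  obtain ⟨p, hp⟩ := hgood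
  have hstep : ∀ n, |digitValue q fun i => c (i + n)| < η →
      |digitValue q fun i => c (i + (n + 1))| < η ∧
        (c n ≠ 0 → 1 - q * η < |digitValue q fun i => c (i + (n + 1))|) := by
    intro n hn
    have := (hc.drop hq1 n).abs_tail_lt hm hq hqc hn
    have e : (fun i => c (i + 1 + n)) = fun i => c (i + (n + 1)) := by
      funext i; congr 1; omega
    rw [e] at this
    simpa using this
  have hall : ∀ n, p ≤ n → |digitValue q fun i => c (i + n)| < η := fun n hn => by
    induction n, hn using Nat.le_induction with
    | base => exact hp
    | succ n _ ih => exact (hstep n ih).1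
  have hnext : ∀ n, p ≤ n → c n ≠ 0 → ∃ j < K, c (n + 1 + j) ≠ 0 := by
    intro n hn hne
    by_contra! hz
    have h1 := (hstep n (hall n hn)).2 hne
    have h2 := digitValue_sub_of_prefix_eq hq1 K (c := fun i => c (i + (n + 1)))
      (d := fun _ => 0) (fun i => hc.1 _) (fun i => by simp)
      (fun i hi => by rw [add_comm]; exact hz i hi)
    have hzero : digitValue q (fun _ => 0) = 0 := by simp [digitValue]
    rw [hzero, sub_zero, sub_zero] at h2
    have h3 := abs_digitValue_le hq1 (c := fun i => c (i + K + (n + 1))) fun i => hc.1 _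
    have h4 : m / (q - 1) ≤ 1 := by rw [div_le_one (by linarith)]; linarith
    rw [h2, abs_div, abs_of_pos (pow_pos hq0 K)] at h1
    have h5 : |digitValue q fun i => c (i + K + (n + 1))| / q ^ K ≤ q⁻¹ ^ K := by
      rw [inv_pow, ← one_div]
      gcongr
      exact h3.trans h4
    linarith
  by_cases hzero : ∃ p, ∀ n, p ≤ n → c n = 0
  · exact Or.inl hzero
  right
  push Not at hzero
  obtain ⟨p', hp', hne⟩ := hzero p
  refine ⟨p', fun n hn => ?_⟩
  -- Slide the window by one place; `hnext` supplies a new nonzero digit when the old one was at the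
  -- left end. Hence the length `K + 1`.
  induction n, hn using Nat.le_induction with
  | base => exact ⟨0, K.succ_pos, hne⟩
  | succ n hn ih =>
    obtain ⟨j, hj, hjne⟩ := ih
    rcases j with _ | j
    · obtain ⟨l, hl, hlne⟩ := hnext n (hp'.trans hn) hjne
      exact ⟨l, by omega, hlne⟩
    · exact ⟨j, by omega, by rwa [show n + 1 + j = n + (j + 1) by omega]⟩

theorem prod_range_add_le {M : ℕ → ℕ} {m K : ℕ} (hM : ∀ i, M i ≤ m + 1) {n : ℕ}
    (h : ∃ j < K, M (n + j) ≤ m) :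
    ∏ i ∈ Finset.range (n + K), M i ≤ (∏ i ∈ Finset.range n, M i) * ((m + 1) ^ (K - 1) * m) := by
  obtain ⟨j, hj, hjm⟩ := h
  rw [Finset.prod_range_add]
  refine Nat.mul_le_mul_left _ ?_
  rw [← Finset.prod_erase_mul _ _ (Finset.mem_range.2 hj)]
  refine Nat.mul_le_mul ?_ hjm
  refine (Finset.prod_le_pow_card _ _ (m + 1) fun i _ => hM _).trans_eq ?_
  rw [Finset.card_erase_of_mem (Finset.mem_range.2 hj), Finset.card_range]

/-- Beyond place `p`, each block of `K` places loses at least one factor `m + 1` to `m`, so it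
contributes at most `ρ ^ K`. The constant absorbs the first `p + K` places. -/
theorem prod_range_le_of_window {M : ℕ → ℕ} {m K p : ℕ} (hm : 1 ≤ m) (hK : 0 < K)
    (hM : ∀ i, M i ≤ m + 1) (h : ∀ n, p ≤ n → ∃ j < K, M (n + j) ≤ m) {ρ : ℝ} (hρ : 1 ≤ ρ)
    (hρK : ρ ^ K = ((m : ℝ) + 1) ^ (K - 1) * m) (n : ℕ) :
    ((∏ i ∈ Finset.range n, M i : ℕ) : ℝ) ≤ ((m : ℝ) + 1) ^ (p + K) * ρ ^ n := by
  induction n using Nat.strong_induction_on with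
  | _ n ih =>
    rcases lt_or_ge n (p + K) with hn | hn
    · have h1 : ∏ i ∈ Finset.range n, M i ≤ (m + 1) ^ (p + K) :=
        (Finset.prod_le_pow_card _ _ (m + 1) fun i _ => hM i).trans
          (Nat.pow_le_pow_right (by omega) (by simpa using hn.le))
      have h2 : ((∏ i ∈ Finset.range n, M i : ℕ) : ℝ) ≤ ((m : ℝ) + 1) ^ (p + K) := by
        exact_mod_cast h1
      exact h2.trans (le_mul_of_one_le_right (by positivity) (one_le_pow₀ hρ))
    · obtain ⟨l, rfl⟩ : ∃ l, n = l + K := ⟨n - K, by omega⟩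
      have h1 := prod_range_add_le hM (h l (by omega))
      have h2 : ((∏ i ∈ Finset.range (l + K), M i : ℕ) : ℝ) ≤
          ((∏ i ∈ Finset.range l, M i : ℕ) : ℝ) * (((m : ℝ) + 1) ^ (K - 1) * m) := by
        exact_mod_cast h1
      rw [← hρK] at h2
      have h3 := mul_le_mul_of_nonneg_right (ih l (by omega)) (show 0 ≤ ρ ^ K by positivity)
      rw [pow_add ρ]
      linarith

theorem le_prod_range_of_eventually {M : ℕ → ℕ} {m p : ℕ} (hM : ∀ i, 1 ≤ M i)
    (h : ∀ n, p ≤ n → M n = m + 1) (n : ℕ) :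
    (((m : ℝ) + 1) ^ p)⁻¹ * ((m : ℝ) + 1) ^ n ≤ ((∏ i ∈ Finset.range n, M i : ℕ) : ℝ) := by
  rw [inv_mul_le_iff₀ (by positivity)]
  suffices H : (m + 1) ^ n ≤ (m + 1) ^ p * ∏ i ∈ Finset.range n, M i by exact_mod_cast H
  induction n with
  | zero => simpa using Nat.one_le_pow _ _ (by omega)
  | succ n ih =>
    rcases lt_or_ge n p with hn | hn
    · exact (Nat.pow_le_pow_right (by omega) hn).trans
        (Nat.le_mul_of_pos_right _ (Finset.prod_pos fun i _ => hM i))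
    · rw [Finset.prod_range_succ, h n hn, pow_succ, ← mul_assoc]
      exact Nat.mul_le_mul_right _ ih

theorem exists_gap_below_max_dim {q : ℝ} {m : ℕ} (hm : 1 ≤ m) (hq : (m : ℝ) + 1 < q)
    (hqc : q < criticalBase m) :
    ∃ δ : ℝ, 0 < δ ∧ ∀ c, IsUniqueDigits q m c →
      Real.logb q (m + 1) ≤ (dimH (gammaInter m m q (digitValue q c))).toReal ∨
        (dimH (gammaInter m m q (digitValue q c))).toReal ≤ Real.logb q (m + 1) - δ := by
  have hm' : (1 : ℝ) ≤ m := by exact_mod_cast hm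
  have hq1 : 1 < q := by linarith
  have hq0 : 0 < q := by linarith
  obtain ⟨K, hK, hwin⟩ := exists_window_of_lt_criticalBase hm hq hqc
  have hK' : (0 : ℝ) < K := by exact_mod_cast hK
  set P : ℝ := ((m : ℝ) + 1) ^ (K - 1) * m with hP
  have hP1 : 1 ≤ P := one_le_mul_of_one_le_of_one_le (one_le_pow₀ (by linarith)) hm'
  -- The geometric mean of the largest product over one window. It depends only on `q` and `m`, so
  -- `δ` is uniform in the sequence.
  set ρ : ℝ := P ^ (1 / K : ℝ) with hρdef
  have hρ : 1 ≤ ρ := Real.one_le_rpow hP1 (by positivity)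
  have hρK : ρ ^ K = P := by
    rw [hρdef, one_div]
    exact Real.rpow_inv_natCast_pow (by linarith) hK.ne'
  have hlt : ρ < m + 1 := by
    refine lt_of_pow_lt_pow_left₀ K (by positivity) ?_
    rw [hρK, hP, ← Nat.sub_add_cancel hK, Nat.add_sub_cancel, pow_succ]
    gcongr
    linarith
  refine ⟨Real.logb q (m + 1) - Real.logb q ρ,
    sub_pos.2 (Real.logb_lt_logb hq1 (by linarith) hlt), fun c hc => ?_⟩
  have hcb : ∀ i, (c i).natAbs ≤ m := fun i => by
    have := abs_le.1 (hc.1 i)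
    omega
  rcases hwin c hc with ⟨p, hp⟩ | ⟨p, hp⟩
  · left
    refine le_dimH_gammaInter hm hq hc (by linarith) (C := (((m : ℝ) + 1) ^ p)⁻¹) (by positivity)
      (le_prod_range_of_eventually (fun i => ?_) fun n hn => ?_)
    · have := hcb i; omega
    · rw [hp n hn]; simp
  · right
    rw [sub_sub_cancel]
    refine dimH_gammaInter_le hm hq hc hρ (C := ((m : ℝ) + 1) ^ (p + K))
      (prod_range_le_of_window hm hK (fun i => by omega) (fun n hn => ?_) hρ hρK)
    obtain ⟨j, hj, hne⟩ := hp n hn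
    exact ⟨j, hj, by have := Int.natAbs_pos.2 hne; omega⟩

/-! ### The theorem -/

theorem theorem1p5 (m : ℕ) (hm : 1 ≤ m) :
    (∀ q : ℝ, criticalBase m ≤ q →
      Set.Icc (Real.log (m : ℝ) / Real.log q) (Real.log ((m : ℝ) + 1) / Real.log q)
        ⊆ dimensionSet m m q) ∧
    (∀ q : ℝ, (m : ℝ) + 1 < q → q < criticalBase m →
      ∃ δ : ℝ, 0 < δ ∧
        dimensionSet m m q ∩
          Set.Ioo (Real.log ((m : ℝ) + 1) / Real.log q - δ)
            (Real.log ((m : ℝ) + 1) / Real.log q) = ∅) := by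
  have hm' : (1 : ℝ) ≤ m := by exact_mod_cast hm
  constructor
  · rintro q hq d ⟨hd1, hd2⟩
    have hmq := (one_div_le_of_criticalBase_le hm hq).1
    have hq1 : 1 < q := by linarith
    have hlogq : 0 < Real.log q := Real.log_pos hq1
    have hlog : Real.log m < Real.log (m + 1) := Real.log_lt_log (by linarith) (by linarith)
    have hD : 0 < Real.log (m + 1) - Real.log m := sub_pos.2 hlog
    rw [div_le_iff₀ hlogq] at hd1
    rw [le_div_iff₀ hlogq] at hd2
    -- The density solving `d * log q = (1 - a) * log (m + 1) + a * log m`.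
    set a : ℝ := (Real.log (m + 1) - d * Real.log q) / (Real.log (m + 1) - Real.log m) with ha
    obtain ⟨t, ht, htd⟩ := exists_dimH_gammaInter_eq hm hq (a := a)
      (div_nonneg (by linarith) hD.le) ((div_le_one hD).2 (by linarith))
    refine ⟨digitValue q t, (mem_uniqueExpansionSet_iff hq1).2 ⟨t, ht, rfl⟩, ?_⟩
    rw [htd, Real.logb, Real.log_mul (by positivity) (by positivity),
      Real.log_rpow (by positivity), Real.log_div (by positivity) (by positivity),
      eq_div_iff hlogq.ne', ha]
    field_simp
    ring
  · intro q hq hqc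
    have hq1 : 1 < q := by linarith
    obtain ⟨δ, hδ, h⟩ := exists_gap_below_max_dim hm hq hqc
    refine ⟨δ, hδ, eq_empty_iff_forall_notMem.2 ?_⟩
    rintro d ⟨⟨t, ht, rfl⟩, hd1, hd2⟩
    obtain ⟨c, hc, rfl⟩ := (mem_uniqueExpansionSet_iff hq1).1 ht
    rcases h c hc with h | h
    · exact absurd hd2 (not_lt.2 h)
    · exact absurd hd1 (not_lt.2 h)
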